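/- All Hilbert spaces are complex. For a contraction $T$ on a Hilbert space $\mathcal H$ put $D_T=(I-T^*T)^{1/2}$, $\mathcal D_T=\overline{\operatorname{Ran}}\,D_T$, and let $$\Theta_T(z)=\big[-T+zD_{T^*}(I-zT^*)^{-1}D_T\big]\big|_{\mathcal D_T}\in\mathcal B(\mathcal D_T,\mathcal D_{T^*}),\qquad |z|<1,$$ be its characteristic function. $T$ is called pure if $T^{*n}\to 0$ strongly. Let $(T_1,T_2)$ be a pair of commuting contractions on $\mathcal H$ and $T=T_1T_2$. An Andô tuple $(\mathcal F_*,\Gamma,P',U')$ for $(T_1^*,T_2^*)$ consists of a Hilbert space $\mathcal F_*=\mathcal D_{T_1^*}\oplus(\mathcal D_{T_2^*}\oplus\mathcal E)$, where $\mathcal E$ is a Hilbert space, the isometry $\Gamma:\mathcal D_{T^*}\to\mathcal F_*$ with $\Gamma D_{T^*}h=D_{T_1^*}T_2^*h\oplus D_{T_2^*}h\oplus 0$ for all $h\in\mathcal H$, the orthogonal projection $P'$ of $\mathcal F_*$ onto $\mathcal D_{T_1^*}$, and a unitary $U'$ on $\mathcal F_*$ such that $U'(D_{T_1^*}T_2^*h\oplus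 D_{T_2^*}h\oplus 0)=D_{T_1^*}h\oplus D_{T_2^*}T_1^*h\oplus 0$ for all $h\in\mathcal H$. A characteristic triple of $(T_1,T_2)$ is a triple $(G_1,G_2,\Theta_T)$, where $$G_1=\Gamma^*(I-P')U'\Gamma,\qquad G_2=\Gamma^*U'^*P'\Gamma\qquad\text{on }\mathcal D_{T^*}$$ for some Andô tuple for $(T_1^*,T_2^*)$. **Theorem 1.5.** Let $(T_1,T_2)$ on $\mathcal H$ and $(T_1',T_2')$ on $\mathcal H'$ be two pairs of commuting contractions such that the products $T=T_1T_2$ and $T'=T_1'T_2'$ are pure. Then both pairs have characteristic triples, and for all characteristic triples $(G_1,G_2,\Theta_T)$ of $(T_1,T_2)$ and $(G_1',G_2',\Theta_{T'})$ of $(T_1',T_2')$ the following are equivalent: 1. $(T_1,T_2)$ and $(T_1',T_2')$ are unitarily equivalent, i.e. there is a unitary $U:\mathcal H\to\mathcal H'$ with $UT_i=T_i'U$ for $i=1,2$; 2. the triples coincide, i.e. there are unitaries $u:\mathcal D_T\to\mathcal D_{T'}$ and $u_*:\mathcal D_{T^*}\to\mathcal D_{T'^*}$ such that $\Theta_{T'}(z)u=u_*\Theta_T(z)$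 for all $|z|<1$ and $u_*G_i=G_i'u_*$ for $i=1,2$. -/

import Mathlib

open Filter Topology
open scoped InnerProduct

universe u v

noncomputable section

namespace CommutingPair

section Defect

variable {H : Type u} [NormedAddCommGroup H] [InnerProductSpace ℂ H] [CompleteSpace H]

/-- The defect operator `D_T = (I - T*T)^{1/2}` of a contraction `T`
(the positive square root given by the continuous functional calculus). -/
def defectOp (T : H →L[ℂ] H) : H →L[ℂ] H := CFC.sqrt (1 - T† * T)

/-- The defect space `𝒟_T`, the closure of the range of `D_T`. -/
def defectSpace (T : H →L[ℂ] H) : Submodule ℂ H :=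
  (LinearMap.range (defectOp T).toLinearMap).topologicalClosure

instance (T : H →L[ℂ] H) : CompleteSpace (defectSpace T) :=
  (Submodule.isClosed_topologicalClosure _).completeSpace_coe

theorem defectOp_mem (T : H →L[ℂ] H) (h : H) : defectOp T h ∈ defectSpace T :=
  Submodule.le_topologicalClosure _ ⟨h, rfl⟩

/-- `D_T h`, regarded as an element of `𝒟_T`. -/
def defectVec (T : H →L[ℂ] H) (h : H) : defectSpace T := ⟨defectOp T h, defectOp_mem T h⟩

theorem one_sub_nonneg {T : H →L[ℂ] H} (hT : ‖T‖ ≤ 1) : 0 ≤ 1 - T† * T := by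
  rw [sub_nonneg]
  refine (CStarAlgebra.norm_le_one_iff_of_nonneg (T† * T) (star_mul_self_nonneg T)).1 ?_
  calc ‖T† * T‖ = ‖T‖ * ‖T‖ := CStarRing.norm_star_mul_self
    _ ≤ 1 := mul_le_one₀ hT (norm_nonneg _) hT

theorem defectOp_isSelfAdjoint (T : H →L[ℂ] H) : (defectOp T)† = defectOp T :=
  (CFC.sqrt_nonneg (1 - T† * T)).isSelfAdjoint

theorem defectOp_mul_self {T : H →L[ℂ] H} (hT : ‖T‖ ≤ 1) :
    defectOp T * defectOp T = 1 - T† * T :=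
  CFC.sqrt_mul_sqrt_self _ (one_sub_nonneg hT)

/-- A contraction `T` maps `𝒟_T` into `𝒟_{T*}`. -/
theorem map_mem_defectSpace {T : H →L[ℂ] H} (hT : ‖T‖ ≤ 1) {x : H} (hx : x ∈ defectSpace T) :
    T x ∈ defectSpace (T†) := by
  have hT' : ‖T†‖ ≤ 1 := by rwa [LinearIsometryEquiv.norm_map]
  have hsub : ∀ (A : H →L[ℂ] H) (a b : H), inner ℂ (defectOp A a) b = inner ℂ a (defectOp A b) := by
    intro A a b
    rw [← ContinuousLinearMap.adjoint_inner_right, defectOp_isSelfAdjoint]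
  -- it suffices to treat `x = D_T h`, by continuity
  have key : ∀ h, T (defectOp T h) ∈ defectSpace (T†) := by
    intro h
    have hcl : (defectSpace (T†))ᗮᗮ = defectSpace (T†) :=
      Submodule.orthogonal_orthogonal _
    rw [← hcl, Submodule.mem_orthogonal]
    intro y hy
    have h0 : defectOp (T†) y = 0 := by
      have h2 := (Submodule.mem_orthogonal _ _).1 hy _ (defectOp_mem (T†) (defectOp (T†) y))
      rw [hsub] at h2
      exact inner_self_eq_zero.1 h2
    have h1 : y - T ((T†) y) = 0 := by
      have h2 := congrArg (fun A : H →L[ℂ] H => A y) (defectOp_mul_self hT')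
      simpa [h0] using h2.symm
    have h3 : defectOp T ((T†) y) = 0 := by
      have h2 := congrArg (fun A : H →L[ℂ] H => A ((T†) y)) (defectOp_mul_self hT)
      have h4 : defectOp T (defectOp T ((T†) y)) = 0 := by
        simpa [← sub_eq_zero.1 h1] using h2
      refine inner_self_eq_zero (𝕜 := ℂ).1 ?_
      rw [hsub, h4, inner_zero_right]
    rw [← ContinuousLinearMap.adjoint_inner_left, ← hsub, h3, inner_zero_left]
  have hle : LinearMap.range (defectOp T).toLinearMap ≤
      (defectSpace (T†)).comap T.toLinearMap := by
    rintro _ ⟨h, rfl⟩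
    exact key h
  exact Submodule.topologicalClosure_minimal _ hle
    ((Submodule.isClosed_topologicalClosure _).preimage T.continuous) hx

/-- The characteristic function of a contraction `T`,
`Θ_T(z) = [-T + z D_{T*} (I - z T*)⁻¹ D_T]|_{𝒟_T} : 𝒟_T → 𝒟_{T*}` for `z` in the open unit disc. -/
def charFun (T : H →L[ℂ] H) (hT : ‖T‖ ≤ 1) (z : Complex.UnitDisc) :
    defectSpace T →L[ℂ] defectSpace (T†) :=
  ((-T + (z : ℂ) • (defectOp (T†) * Ring.inverse (1 - (z : ℂ) • T†) * defectOp T)).comp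
    (defectSpace T).subtypeL).codRestrict (defectSpace (T†)) (fun x =>
      Submodule.add_mem _ (Submodule.neg_mem _ (map_mem_defectSpace hT x.2))
        (Submodule.smul_mem _ _ (defectOp_mem (T†) _)))

/-- `T` is pure: `T*ⁿ → 0` in the strong operator topology. -/
def IsPure (T : H →L[ℂ] H) : Prop :=
  ∀ h : H, Tendsto (fun n : ℕ => ((T†) ^ n) h) atTop (𝓝 0)

/-- The Hilbert space `𝒟_{T₁} ⊕ (𝒟_{T₂} ⊕ E)` (orthogonal direct sums). -/
abbrev AndoSpace (T₁ T₂ : H →L[ℂ] H) (E : Type u) [NormedAddCommGroup E] : Type u :=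
  WithLp 2 (defectSpace T₁ × WithLp 2 (defectSpace T₂ × E))

/-- The vector `f ⊕ g ⊕ e` of `𝒟_{T₁} ⊕ (𝒟_{T₂} ⊕ E)`. -/
def andoVec {T₁ T₂ : H →L[ℂ] H} {E : Type u} [NormedAddCommGroup E]
    (f : defectSpace T₁) (g : defectSpace T₂) (e : E) : AndoSpace T₁ T₂ E :=
  WithLp.toLp 2 (f, WithLp.toLp 2 (g, e))

/-- The orthogonal projection `f ⊕ g ⊕ e ↦ f ⊕ 0 ⊕ 0` onto `𝒟_{T₁}`. -/
def andoProj (T₁ T₂ : H →L[ℂ] H) (E : Type u) [NormedAddCommGroup E] [InnerProductSpace ℂ E] :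
    AndoSpace T₁ T₂ E →L[ℂ] AndoSpace T₁ T₂ E :=
  let e := WithLp.prodContinuousLinearEquiv 2 ℂ (defectSpace T₁) (WithLp 2 (defectSpace T₂ × E))
  e.symm.toContinuousLinearMap ∘L
    (ContinuousLinearMap.inl ℂ (defectSpace T₁) (WithLp 2 (defectSpace T₂ × E)) ∘L
      ContinuousLinearMap.fst ℂ (defectSpace T₁) (WithLp 2 (defectSpace T₂ × E))) ∘L
    e.toContinuousLinearMap

theorem andoProj_andoVec {T₁ T₂ : H →L[ℂ] H} {E : Type u} [NormedAddCommGroup E]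
    [InnerProductSpace ℂ E] (f : defectSpace T₁) (g : defectSpace T₂) (e : E) :
    andoProj T₁ T₂ E (andoVec f g e) = andoVec f 0 0 := rfl

/-- An Andô tuple for commuting contractions `T₁, T₂` with product `T`, on the space
`𝓕 = 𝒟_{T₁} ⊕ (𝒟_{T₂} ⊕ E)`; the projection `P` of the tuple is `andoProj T₁ T₂ E`.
The Hilbert space `E` is the space that is added, when needed, so that the isometry
`D_{T₁} T₂ h ⊕ D_{T₂} h ↦ D_{T₁} h ⊕ D_{T₂} T₁ h` extends to a unitary `U` of `𝓕`
(`E = 0` if nothing is needed, `E = ℓ²` always suffices for separable spaces). -/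
structure AndoTuple (T₁ T₂ T : H →L[ℂ] H) (E : Type u) [NormedAddCommGroup E]
    [InnerProductSpace ℂ E] where
  prod_eq : T = T₁ * T₂
  /-- the isometry `Λ : 𝒟_T → 𝓕` -/
  isom : defectSpace T →ₗᵢ[ℂ] AndoSpace T₁ T₂ E
  isom_apply : ∀ h : H, isom (defectVec T h) = andoVec (defectVec T₁ (T₂ h)) (defectVec T₂ h) 0
  /-- the unitary `U` on `𝓕` -/
  unitary : AndoSpace T₁ T₂ E ≃ₗᵢ[ℂ] AndoSpace T₁ T₂ E
  unitary_apply : ∀ h : H, unitary (andoVec (defectVec T₁ (T₂ h)) (defectVec T₂ h) 0) =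
    andoVec (defectVec T₁ h) (defectVec T₂ (T₁ h)) 0

section

variable {T₁ T₂ T : H →L[ℂ] H} {E : Type u} [NormedAddCommGroup E] [InnerProductSpace ℂ E]
  [CompleteSpace E]

/-- `Λ* P^⊥ U Λ` on `𝒟_T`. -/
def AndoTuple.fund₁ (A : AndoTuple T₁ T₂ T E) : defectSpace T →L[ℂ] defectSpace T :=
  A.isom.toContinuousLinearMap† ∘L (1 - andoProj T₁ T₂ E) ∘L
    (A.unitary : AndoSpace T₁ T₂ E →L[ℂ] AndoSpace T₁ T₂ E) ∘L A.isom.toContinuousLinearMap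

/-- `Λ* U* P Λ` on `𝒟_T`. -/
def AndoTuple.fund₂ (A : AndoTuple T₁ T₂ T E) : defectSpace T →L[ℂ] defectSpace T :=
  A.isom.toContinuousLinearMap† ∘L
    (A.unitary : AndoSpace T₁ T₂ E →L[ℂ] AndoSpace T₁ T₂ E)† ∘L
      andoProj T₁ T₂ E ∘L A.isom.toContinuousLinearMap

end

end Defect

/-- A pair of commuting contractions on a Hilbert space. -/
structure CommutingContractions (H : Type u) [NormedAddCommGroup H] [InnerProductSpace ℂ H] where
  T₁ : H →L[ℂ] H
  T₂ : H →L[ℂ] H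
  norm_le₁ : ‖T₁‖ ≤ 1
  norm_le₂ : ‖T₂‖ ≤ 1
  comm : T₁ * T₂ = T₂ * T₁

/-- The product `T = T₁T₂`. -/
def CommutingContractions.prod {H : Type u} [NormedAddCommGroup H] [InnerProductSpace ℂ H]
    (S : CommutingContractions H) : H →L[ℂ] H := S.T₁ * S.T₂

theorem CommutingContractions.norm_prod_le {H : Type u} [NormedAddCommGroup H]
    [InnerProductSpace ℂ H] (S : CommutingContractions H) : ‖S.prod‖ ≤ 1 :=
  (norm_mul_le _ _).trans (mul_le_one₀ S.norm_le₁ (norm_nonneg _) S.norm_le₂)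

/-- Two pairs of operators are unitarily equivalent: one unitary intertwines both
`T₁` with `T₁'` and `T₂` with `T₂'`. -/
def UnitarilyEquivalent {H : Type u} [NormedAddCommGroup H] [InnerProductSpace ℂ H]
    {H' : Type v} [NormedAddCommGroup H'] [InnerProductSpace ℂ H']
    (S : CommutingContractions H) (S' : CommutingContractions H') : Prop :=
  ∃ U : H ≃ₗᵢ[ℂ] H', (∀ h, U (S.T₁ h) = S'.T₁ (U h)) ∧ (∀ h, U (S.T₂ h) = S'.T₂ (U h))

/-- Triples `(G₁, G₂, Θ)`: two operators on `𝒟_*` and an operator-valued function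
`Θ : 𝔻 → 𝓑(𝒟, 𝒟_*)`. -/
structure OperatorTriple (D Ds : Type*) [NormedAddCommGroup D] [InnerProductSpace ℂ D]
    [NormedAddCommGroup Ds] [InnerProductSpace ℂ Ds] where
  G₁ : Ds →L[ℂ] Ds
  G₂ : Ds →L[ℂ] Ds
  Θ : Complex.UnitDisc → D →L[ℂ] Ds

/-- Coincidence of triples: there are unitaries `u : 𝒟 → 𝒟'` and `u_* : 𝒟_* → 𝒟_*'` with
`Θ'(z) u = u_* Θ(z)` for all `z ∈ 𝔻` and `u_* G_i = G_i' u_*` for `i = 1, 2`. -/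
def OperatorTriple.Coincides {D Ds D' Ds' : Type*}
    [NormedAddCommGroup D] [InnerProductSpace ℂ D] [NormedAddCommGroup Ds] [InnerProductSpace ℂ Ds]
    [NormedAddCommGroup D'] [InnerProductSpace ℂ D']
    [NormedAddCommGroup Ds'] [InnerProductSpace ℂ Ds']
    (τ : OperatorTriple D Ds) (τ' : OperatorTriple D' Ds') : Prop :=
  ∃ (w : D ≃ₗᵢ[ℂ] D') (ws : Ds ≃ₗᵢ[ℂ] Ds'),
    (∀ z x, τ'.Θ z (w x) = ws (τ.Θ z x)) ∧
    (∀ y, ws (τ.G₁ y) = τ'.G₁ (ws y)) ∧ (∀ y, ws (τ.G₂ y) = τ'.G₂ (ws y))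

/-- `τ` is the characteristic triple of `(T₁, T₂)`: with `T = T₁T₂` and some Andô tuple
`(𝓕_*, Γ, P', U')` for `(T₁*, T₂*)` (whose product is `T*`),
`τ = (Γ* P'^⊥ U' Γ, Γ* U'* P' Γ, Θ_T)`. -/
def IsCharacteristicTriple {H : Type u} [NormedAddCommGroup H] [InnerProductSpace ℂ H]
    [CompleteSpace H] (S : CommutingContractions H)
    (τ : OperatorTriple (defectSpace S.prod) (defectSpace (S.prod†))) : Prop :=
  ∃ (E : Type u) (_ : NormedAddCommGroup E) (_ : InnerProductSpace ℂ E) (_ : CompleteSpace E)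
    (A : AndoTuple (S.T₁†) (S.T₂†) (S.prod†) E),
    τ.G₁ = A.fund₁ ∧ τ.G₂ = A.fund₂ ∧ τ.Θ = charFun S.prod S.norm_prod_le

end CommutingPair

end

/-! Compressing the defining relations of an Andô tuple to vectors `D_{T*} h` gives `D_{T*} G₁
D_{T*} = T₁* - T₂ T*` and `D_{T*} G₂ D_{T*} = T₂* - T₁ T*` (`AndoTuple.inner_fund₁`,
`AndoTuple.inner_fund₂`). As `D_{T*}` has dense range in the defect space, the triple depends on the
pair alone and not on `𝓔` or `U'`. A unitary equivalence therefore carries one triple to the other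
through the unitaries it induces on the defect spaces.

Conversely, `I - Θ_T(z) Θ_T(w)*` determines the Gram matrix of the vectors `(1 - z̄T)⁻¹ D_{T*} y`
(`inner_adjoint_charFun`), and purity makes these vectors total (`IsPure.eq_zero_of_resolv`).
Coincidence of the characteristic functions thus yields a unitary `U : H → H'` compatible with
`D_{T*} (1 - zT*)⁻¹`. The relation `D_{T*} T₁* = G₁ D_{T*} + G₂* D_{T*} T*` and its mirror image
(`defectMap_apply_eq_fund`) then force `U` to intertwine `T₁*` and `T₂*`, hence `T₁` and `T₂`.

Existence of a tuple reduces to extending an isometry between subspaces of `K` to a unitary of `K ⊕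
K`, by Halmos' block matrix. -/

noncomputable section

namespace CommutingPair

/-- A map into the closure of the range of `f` that agrees with `f` has dense range. -/
theorem denseRange_of_coe_eq {V F : Type*} [AddCommGroup V] [Module ℂ V] [NormedAddCommGroup F]
    [NormedSpace ℂ F] (f : V →ₗ[ℂ] F) (g : V → (LinearMap.range f).topologicalClosure)
    (hg : ∀ v, (g v : F) = f v) : DenseRange g := by
  intro x
  rw [closure_subtype]
  have hx : (x : F) ∈ closure (LinearMap.range f : Set F) := by
    rw [← Submodule.topologicalClosure_coe]; exact x.2
  refine closure_mono ?_ hx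
  rintro _ ⟨v, rfl⟩
  exact ⟨_, ⟨v, rfl⟩, hg v⟩

/-! ### Defect operators: the relation `T D_T = D_{T*} T` and inner products of defect vectors. -/

section Intertwining

variable {H : Type u} [NormedAddCommGroup H] [InnerProductSpace ℂ H] [CompleteSpace H]

/-- If `a² t = t b²` with `a, b ≥ 0`, then `a t = t b`. -/
theorem mul_eq_mul_of_sq {a b t : H →L[ℂ] H} (ha : 0 ≤ a) (hb : 0 ≤ b)
    (h : a * a * t = t * (b * b)) : a * t = t * b := by
  have hbs : star b = b := hb.isSelfAdjoint
  have has : star a = a := ha.isSelfAdjoint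
  -- The difference solves the Sylvester equation `a w = -w b`. Then `w*w b = -w*a w` is at once
  -- negative and, as a product of commuting positive operators, positive, so it vanishes; this
  -- kills `w b` and `a w`, and then `w` itself.
  obtain ⟨w, hw⟩ : ∃ w, w = a * t - t * b := ⟨_, rfl⟩
  have h1 : a * w = -(w * b) := by
    rw [hw, mul_sub, ← mul_assoc, h]; noncomm_ring
  have h2 : 0 ≤ star w * a * w := star_left_conjugate_nonneg ha w
  have h3 : star w * w * b = -(star w * a * w) := by
    rw [mul_assoc, mul_assoc, h1, mul_neg, neg_neg]
  have h4 : 0 ≤ star w * w * b := by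
    refine Commute.mul_nonneg (star_mul_self_nonneg w) hb ?_
    refine ((star_mul_self_nonneg w).isSelfAdjoint.commute_iff hb.isSelfAdjoint).2 ?_
    rw [h3]
    exact h2.isSelfAdjoint.neg
  have h5 : star w * w * b = 0 := le_antisymm (by rw [h3]; exact neg_nonpos.2 h2) h4
  have h6 : w * b = 0 := by
    rw [← CStarRing.star_mul_self_eq_zero_iff, star_mul, mul_assoc, ← mul_assoc (star w), h5,
      mul_zero]
  have h7 : a * w = 0 := by rw [h1, h6, neg_zero]
  have h8 : star w * w = -(b * (star t * w)) := by
    conv_lhs => rw [hw]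
    rw [star_sub, star_mul, star_mul, has, hbs, ← hw, sub_mul, mul_assoc, h7]
    noncomm_ring
  have h9 : star (star w * w) * (star w * w) = 0 := by
    rw [(star_mul_self_nonneg w).isSelfAdjoint.star_eq]
    nth_rw 2 [h8]
    rw [mul_neg, ← mul_assoc, h5, zero_mul, neg_zero]
  rw [CStarRing.star_mul_self_eq_zero_iff, CStarRing.star_mul_self_eq_zero_iff, hw] at h9
  exact sub_eq_zero.1 h9

/-- `T D_T = D_{T*} T`. -/
theorem defectOp_adjoint_apply {T : H →L[ℂ] H} (hT : ‖T‖ ≤ 1) (h : H) :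
    defectOp (T†) (T h) = T (defectOp T h) := by
  have hT' : ‖T†‖ ≤ 1 := by rwa [LinearIsometryEquiv.norm_map]
  have key : defectOp (T†) * T = T * defectOp T := by
    refine mul_eq_mul_of_sq (CFC.sqrt_nonneg _) (CFC.sqrt_nonneg _) ?_
    rw [defectOp_mul_self hT, defectOp_mul_self hT', ContinuousLinearMap.adjoint_adjoint]
    noncomm_ring
  exact congrArg (fun A : H →L[ℂ] H => A h) key

/-- `D_T` as a bounded operator from `H` to `𝒟_T`. -/
def defectMap (T : H →L[ℂ] H) : H →L[ℂ] defectSpace T :=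
  (defectOp T).codRestrict (defectSpace T) (defectOp_mem T)

@[simp]
theorem coe_defectMap (T : H →L[ℂ] H) (h : H) : (defectMap T h : H) = defectOp T h := rfl

theorem defectMap_eq_defectVec (T : H →L[ℂ] H) (h : H) : defectMap T h = defectVec T h := rfl

theorem denseRange_defectMap (T : H →L[ℂ] H) : DenseRange (defectMap T) :=
  denseRange_of_coe_eq (defectOp T).toLinearMap _ fun _ => rfl

theorem inner_defectOp_left (T : H →L[ℂ] H) (h k : H) :
    inner ℂ (defectOp T h) k = inner ℂ h (defectOp T k) := by
  rw [← ContinuousLinearMap.adjoint_inner_right, defectOp_isSelfAdjoint]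

theorem adjoint_defectMap_apply (T : H →L[ℂ] H) (y : defectSpace T) :
    ((defectMap T)†) y = defectOp T y := by
  refine ext_inner_left ℂ fun h => ?_
  rw [ContinuousLinearMap.adjoint_inner_right, Submodule.coe_inner, coe_defectMap,
    inner_defectOp_left]

theorem defectOp_defectOp {T : H →L[ℂ] H} (hT : ‖T‖ ≤ 1) (h : H) :
    defectOp T (defectOp T h) = h - (T†) (T h) :=
  congrArg (fun A : H →L[ℂ] H => A h) (defectOp_mul_self hT)

theorem inner_defectMap {T : H →L[ℂ] H} (hT : ‖T‖ ≤ 1) (h k : H) :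
    inner ℂ (defectMap T h) (defectMap T k) = inner ℂ h k - inner ℂ (T h) (T k) := by
  rw [← ContinuousLinearMap.adjoint_inner_right, adjoint_defectMap_apply, coe_defectMap,
    defectOp_defectOp hT, inner_sub_right, ContinuousLinearMap.adjoint_inner_right]

theorem norm_sq_defectMap {T : H →L[ℂ] H} (hT : ‖T‖ ≤ 1) (h : H) :
    ‖defectMap T h‖ ^ 2 = ‖h‖ ^ 2 - ‖T h‖ ^ 2 := by
  have := inner_defectMap hT h h
  simp only [inner_self_eq_norm_sq_to_K] at this
  exact_mod_cast this

end Intertwining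

/-! ### Extension of isometries by density. -/

section Extension

variable {V F G : Type*} [AddCommGroup V] [Module ℂ V]
  [NormedAddCommGroup F] [NormedSpace ℂ F] [NormedAddCommGroup G] [NormedSpace ℂ G]

theorem exists_linearIsometry_of_norm_eq [CompleteSpace G] (f : V →ₗ[ℂ] F) (g : V →ₗ[ℂ] G)
    (hf : DenseRange f) (h : ∀ x, ‖g x‖ = ‖f x‖) :
    ∃ L : F →ₗᵢ[ℂ] G, ∀ x, L (f x) = g x := by
  have hb : ∃ C : ℝ, ∀ x, ‖g x‖ ≤ C * ‖f x‖ := ⟨1, fun x => by simp [h]⟩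
  refine ⟨⟨(g.extendOfNorm f).toLinearMap, ?_⟩, fun x => LinearMap.extendOfNorm_eq hf hb x⟩
  refine hf.induction ?_ (isClosed_eq (by
    simp only [ContinuousLinearMap.coe_coe]; fun_prop) continuous_norm)
  rintro _ ⟨x, rfl⟩
  rw [ContinuousLinearMap.coe_coe, LinearMap.extendOfNorm_eq hf hb, h]

theorem exists_linearIsometryEquiv_of_norm_eq [CompleteSpace F] [CompleteSpace G]
    (f : V →ₗ[ℂ] F) (g : V →ₗ[ℂ] G)
    (hf : DenseRange f) (hg : DenseRange g) (h : ∀ x, ‖g x‖ = ‖f x‖) :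
    ∃ L : F ≃ₗᵢ[ℂ] G, ∀ x, L (f x) = g x := by
  refine ⟨(LinearEquiv.refl ℂ V).extendOfIsometry f g hf hg h, fun x => ?_⟩
  exact LinearMap.extendOfNorm_eq (f := g) hf ⟨1, fun x => by simp [h]⟩ x

end Extension

/-! ### Unitaries from equal Gram matrices. -/

section InnerExtension

variable {ι F G : Type*} [NormedAddCommGroup F] [InnerProductSpace ℂ F] [CompleteSpace F]
  [NormedAddCommGroup G] [InnerProductSpace ℂ G] [CompleteSpace G]

theorem denseRange_linearCombination {a : ι → F} (ha : ∀ x, (∀ i, inner ℂ x (a i) = 0) → x = 0) :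
    DenseRange (Finsupp.linearCombination ℂ a) := by
  have h : (LinearMap.range (Finsupp.linearCombination ℂ a)).topologicalClosure = ⊤ := by
    rw [Submodule.topologicalClosure_eq_top_iff, Submodule.eq_bot_iff]
    refine fun x hx => ha x fun i => ?_
    exact (Submodule.mem_orthogonal' _ _).1 hx _ ⟨Finsupp.single i 1, by simp⟩
  intro x
  have : x ∈ (LinearMap.range (Finsupp.linearCombination ℂ a)).topologicalClosure := by
    rw [h]; trivial
  rw [← SetLike.mem_coe, Submodule.topologicalClosure_coe] at this
  exact this

/-- Two total families with the same Gram matrix are unitarily equivalent. -/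
theorem exists_linearIsometryEquiv_of_gram_eq (a : ι → F) (b : ι → G)
    (ha : ∀ x, (∀ i, inner ℂ x (a i) = 0) → x = 0) (hb : ∀ x, (∀ i, inner ℂ x (b i) = 0) → x = 0)
    (h : ∀ i j, inner ℂ (b i) (b j) = inner ℂ (a i) (a j)) :
    ∃ L : F ≃ₗᵢ[ℂ] G, ∀ i, L (a i) = b i := by
  obtain ⟨L, hL⟩ := exists_linearIsometryEquiv_of_norm_eq _ _ (denseRange_linearCombination ha)
    (denseRange_linearCombination hb) (fun x => by
      have : inner ℂ (Finsupp.linearCombination ℂ b x) (Finsupp.linearCombination ℂ b x) =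
          inner ℂ (Finsupp.linearCombination ℂ a x) (Finsupp.linearCombination ℂ a x) := by
        simp only [Finsupp.linearCombination_apply, Finsupp.sum_inner, Finsupp.inner_sum,
          inner_smul_left, inner_smul_right, h]
      simp only [inner_self_eq_norm_sq_to_K] at this
      have h2 : ‖Finsupp.linearCombination ℂ b x‖ ^ 2 = ‖Finsupp.linearCombination ℂ a x‖ ^ 2 := by
        exact_mod_cast this
      exact (sq_eq_sq₀ (norm_nonneg _) (norm_nonneg _)).1 h2)
  refine ⟨L, fun i => ?_⟩
  simpa using hL (Finsupp.single i 1)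

end InnerExtension

/-! ### Unitary extension of partial isometries. -/

section Halmos

variable {K : Type*} [NormedAddCommGroup K] [InnerProductSpace ℂ K] [CompleteSpace K]

/-- The Halmos dilation of a partial isometry: a unitary on `K ⊕ K` whose compression to the
first summand is the partial isometry. -/
theorem exists_unitary_extension_of_partialIsometry (V : K →L[ℂ] K)
    (hV : ∀ x, V ((V†) (V x)) = V x) :
    ∃ U : WithLp 2 (K × K) ≃ₗᵢ[ℂ] WithLp 2 (K × K), ∀ x, (V†) (V x) = x →
      U (WithLp.toLp 2 (x, 0)) = WithLp.toLp 2 (V x, 0) := by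
  have hV' : ∀ x, (V†) (V ((V†) x)) = (V†) x := by
    intro x
    refine ext_inner_right ℂ fun y => ?_
    rw [ContinuousLinearMap.adjoint_inner_left, ← ContinuousLinearMap.adjoint_inner_right,
      ContinuousLinearMap.adjoint_inner_left, hV, ContinuousLinearMap.adjoint_inner_left]
  -- The block matrix with rows `(W, 1 - WW*)` and `(1 - W*W, -W*)`. For a partial isometry the
  -- defect operators are projections, so no square roots appear; replacing `W` by `W*` gives both
  -- the adjoint and the inverse.
  let f : (W : K →L[ℂ] K) → WithLp 2 (K × K) → WithLp 2 (K × K) := fun W p =>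
    WithLp.toLp 2 (W p.fst + (p.snd - W ((W†) p.snd)), (p.fst - (W†) (W p.fst)) - (W†) p.snd)
  have hadj : ∀ p q, inner ℂ (f V p) q = inner ℂ p (f (V†) q) := by
    intro p q
    simp only [f, WithLp.prod_inner_apply, WithLp.ofLp_fst, WithLp.ofLp_snd, inner_add_left,
      inner_add_right, inner_sub_left, inner_sub_right, ContinuousLinearMap.adjoint_adjoint]
    have h1 : inner ℂ (V ((V†) p.snd)) q.fst = inner ℂ p.snd (V ((V†) q.fst)) := by
      rw [← ContinuousLinearMap.adjoint_inner_right, ContinuousLinearMap.adjoint_inner_left]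
    simp only [ContinuousLinearMap.adjoint_inner_left, ContinuousLinearMap.adjoint_inner_right, h1]
    ring
  have hinv : ∀ W : K →L[ℂ] K, (∀ x, W ((W†) (W x)) = W x) → (∀ x, (W†) (W ((W†) x)) = (W†) x) →
      ∀ p, f (W†) (f W p) = p := by
    intro W h h' p
    apply WithLp.ofLp_injective
    ext1 <;>
      simp only [f, map_add, map_sub, ContinuousLinearMap.adjoint_adjoint, h, h',
        WithLp.ofLp_fst, WithLp.ofLp_snd, WithLp.toLp_fst, WithLp.toLp_snd] <;> abel
  let L : WithLp 2 (K × K) ≃ₗ[ℂ] WithLp 2 (K × K) :=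
    { toFun := f V
      invFun := f (V†)
      map_add' := by
        intro p q
        apply WithLp.ofLp_injective
        ext1 <;> simp [f] <;> abel
      map_smul' := by
        intro c p
        apply WithLp.ofLp_injective
        ext1 <;> simp [f, smul_sub]
      left_inv := hinv V hV hV'
      right_inv := fun p => by
        have := hinv (V†) (by simpa using hV') (by simpa using hV) p
        rwa [ContinuousLinearMap.adjoint_adjoint] at this }
  refine ⟨⟨L, fun p => ?_⟩, fun x hx => ?_⟩
  · have h1 : inner ℂ (L p) (L p) = inner ℂ p p := by
      change inner ℂ (f V p) (f V p) = _
      rw [hadj, hinv V hV hV']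
    simp only [inner_self_eq_norm_sq_to_K] at h1
    have h2 : ‖L p‖ ^ 2 = ‖p‖ ^ 2 := by exact_mod_cast h1
    exact (sq_eq_sq₀ (norm_nonneg _) (norm_nonneg _)).1 h2
  · change f V _ = _
    simp [f, hx]

/-- An isometry between two sets of the form `{f v}`, `{g v}` in `K` extends to a unitary of
`K ⊕ K`. -/
theorem exists_unitary_extension {V : Type*} [AddCommGroup V] [Module ℂ V]
    (f g : V →ₗ[ℂ] K) (h : ∀ x, ‖g x‖ = ‖f x‖) :
    ∃ U : WithLp 2 (K × K) ≃ₗᵢ[ℂ] WithLp 2 (K × K), ∀ x,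
      U (WithLp.toLp 2 (f x, 0)) = WithLp.toLp 2 (g x, 0) := by
  let M : Submodule ℂ K := (LinearMap.range f).topologicalClosure
  have : CompleteSpace M := (Submodule.isClosed_topologicalClosure _).completeSpace_coe
  have hfM : ∀ v, f v ∈ M := fun v => Submodule.le_topologicalClosure _ ⟨v, rfl⟩
  let f' : V →ₗ[ℂ] M := f.codRestrict M hfM
  have hf' : DenseRange f' := denseRange_of_coe_eq f _ fun _ => rfl
  obtain ⟨L, hL⟩ := exists_linearIsometry_of_norm_eq f' g hf' h
  let W : K →L[ℂ] K := L.toContinuousLinearMap ∘L M.orthogonalProjectionOnto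
  have hLL : ∀ x, (L.toContinuousLinearMap†) (L x) = x := fun x =>
    ext_inner_right ℂ fun y => by
      rw [ContinuousLinearMap.adjoint_inner_left]
      exact L.inner_map_map x y
  have hW : ∀ x, (W†) (W x) = M.orthogonalProjectionOnto x := by
    intro x
    simp only [W, ContinuousLinearMap.adjoint_comp, Submodule.adjoint_orthogonalProjectionOnto]
    simp [hLL]
  obtain ⟨U, hU⟩ := exists_unitary_extension_of_partialIsometry W (fun x => by
    rw [hW]
    change L (M.orthogonalProjectionOnto (M.orthogonalProjectionOnto x : K)) = _
    rw [Submodule.orthogonalProjectionOnto_mem_subspace_eq_self]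
    rfl)
  refine ⟨U, fun v => ?_⟩
  have hv : M.orthogonalProjectionOnto (f v) = f' v :=
    Submodule.orthogonalProjectionOnto_mem_subspace_eq_self (f' v)
  rw [hU, ← hL v]
  · simp [W, hv]
  · rw [hW, hv]; rfl

end Halmos

/-! ### Existence of Andô tuples and the fundamental operators. -/

section Ando

variable {H : Type u} [NormedAddCommGroup H] [InnerProductSpace ℂ H] [CompleteSpace H]

theorem inner_andoVec {T₁ T₂ : H →L[ℂ] H} {E : Type u} [NormedAddCommGroup E]
    [InnerProductSpace ℂ E] (f f' : defectSpace T₁) (g g' : defectSpace T₂) (e e' : E) :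
    inner ℂ (andoVec f g e) (andoVec f' g' e') =
      inner ℂ f f' + (inner ℂ g g' + inner ℂ e e') := by
  simp only [andoVec, WithLp.prod_inner_apply]

theorem norm_sq_andoVec {T₁ T₂ : H →L[ℂ] H} {E : Type u} [NormedAddCommGroup E]
    [InnerProductSpace ℂ E] (f : defectSpace T₁) (g : defectSpace T₂) :
    ‖andoVec f g (0 : E)‖ ^ 2 = ‖f‖ ^ 2 + ‖g‖ ^ 2 := by
  have := inner_andoVec f f g g (0 : E) 0
  simp only [inner_self_eq_norm_sq_to_K, norm_zero] at this
  have h : ‖andoVec f g (0 : E)‖ ^ 2 = ‖f‖ ^ 2 + (‖g‖ ^ 2 + 0 ^ 2) := by exact_mod_cast this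
  linarith

/-- The terms `‖B h‖²` cancel, so only the product `AB` remains. This gives both the isometry on
`𝒟_{AB}` and, when `A` and `B` commute, the symmetry that makes the prescribed part of the unitary
isometric. -/
theorem norm_sq_defectMap_add {A B : H →L[ℂ] H} (hA : ‖A‖ ≤ 1) (hB : ‖B‖ ≤ 1) (h : H) :
    ‖defectMap A (B h)‖ ^ 2 + ‖defectMap B h‖ ^ 2 = ‖h‖ ^ 2 - ‖A (B h)‖ ^ 2 := by
  rw [norm_sq_defectMap hA, norm_sq_defectMap hB]
  ring

/-- Commuting contractions have an Andô tuple, with `E = 𝒟_A ⊕ 𝒟_B`. -/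
theorem exists_andoTuple {A B T : H →L[ℂ] H} (hA : ‖A‖ ≤ 1) (hB : ‖B‖ ≤ 1)
    (hAB : A * B = B * A) (hT : T = A * B) :
    Nonempty (AndoTuple A B T (WithLp 2 (defectSpace A × defectSpace B))) := by
  have hTn : ‖T‖ ≤ 1 := hT ▸ (norm_mul_le _ _).trans (mul_le_one₀ hA (norm_nonneg _) hB)
  have hcomm : ∀ h, A (B h) = B (A h) := fun h => congrArg (fun X : H →L[ℂ] H => X h) hAB
  -- With `K = 𝒟_A ⊕ 𝒟_B`, this choice turns the Andô space into `K ⊕ K` after reassociation, where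
  -- the Halmos extension applies.
  let E := WithLp 2 (defectSpace A × defectSpace B)
  let incl : H →ₗ[ℂ] AndoSpace A B E :=
    { toFun := fun h => andoVec (defectMap A (B h)) (defectMap B h) 0
      map_add' := fun x y => by
        simp only [map_add, andoVec, ← WithLp.toLp_add, Prod.mk_add_mk, add_zero]
      map_smul' := fun c x => by
        simp only [map_smul, andoVec, ← WithLp.toLp_smul, Prod.smul_mk, smul_zero,
          RingHom.id_apply] }
  obtain ⟨Λ, hΛ⟩ := exists_linearIsometry_of_norm_eq (defectMap T).toLinearMap incl
    (denseRange_defectMap T) (fun h => by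
      refine (sq_eq_sq₀ (norm_nonneg _) (norm_nonneg _)).1 ?_
      change ‖andoVec (defectMap A (B h)) (defectMap B h) (0 : E)‖ ^ 2 = ‖defectMap T h‖ ^ 2
      rw [norm_sq_andoVec, norm_sq_defectMap_add hA hB, norm_sq_defectMap hTn, hT]
      rfl)
  let pairing (X Y : H →L[ℂ] H) : H →ₗ[ℂ] E :=
    (WithLp.linearEquiv 2 ℂ (defectSpace A × defectSpace B)).symm.toLinearMap ∘ₗ
      ((defectMap A ∘L X).prod (defectMap B ∘L Y)).toLinearMap
  have hpair : ∀ X Y h, ‖pairing X Y h‖ ^ 2 =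
      ‖defectMap A (X h)‖ ^ 2 + ‖defectMap B (Y h)‖ ^ 2 := fun X Y h => by
    rw [WithLp.prod_norm_sq_eq_of_L2]
    rfl
  obtain ⟨U, hU⟩ := exists_unitary_extension (pairing B 1) (pairing 1 A) (fun h => by
      refine (sq_eq_sq₀ (norm_nonneg _) (norm_nonneg _)).1 ?_
      simp only [hpair, one_apply_eq_self]
      rw [add_comm, norm_sq_defectMap_add hA hB, norm_sq_defectMap_add hB hA, hcomm])
  let e := LinearIsometryEquiv.withLpProdAssoc 2 ℂ (defectSpace A) (defectSpace B) E
  refine ⟨⟨hT, Λ, hΛ, (e.symm.trans U).trans e, fun h => ?_⟩⟩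
  exact congrArg e (hU h)

variable {T₁ T₂ T : H →L[ℂ] H} {E : Type u} [NormedAddCommGroup E] [InnerProductSpace ℂ E]
  [CompleteSpace E]

/-- The unitary acts here only on vectors where its values are prescribed, so neither `E` nor the
choice of extension survives on the right. In `inner_fund₂` the same happens once the adjoint of the
unitary is moved to the other side. -/
theorem AndoTuple.inner_fund₁ (A : AndoTuple T₁ T₂ T E) (h₂ : ‖T₂‖ ≤ 1)
    (hc : T₁ * T₂ = T₂ * T₁) (h k : H) :
    inner ℂ (A.fund₁ (defectMap T h)) (defectMap T k) =
      inner ℂ (T₁ h) k - inner ℂ (T h) (T₂ k) := by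
  have h1 : A.fund₁ (defectMap T h) = (A.isom.toContinuousLinearMap†)
      (A.unitary (A.isom (defectVec T h)) -
        andoProj T₁ T₂ E (A.unitary (A.isom (defectVec T h)))) := rfl
  have h2 : A.isom (defectMap T k) = andoVec (defectVec T₁ (T₂ k)) (defectVec T₂ k) 0 :=
    A.isom_apply k
  rw [h1, ContinuousLinearMap.adjoint_inner_left, LinearIsometry.coe_toContinuousLinearMap, h2,
    A.isom_apply, A.unitary_apply, andoProj_andoVec, inner_sub_left, inner_andoVec, inner_andoVec,
    ← defectMap_eq_defectVec T₂, ← defectMap_eq_defectVec T₂, inner_defectMap h₂, A.prod_eq, hc,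
    inner_zero_left, inner_zero_left, mul_apply_eq_comp]
  ring

theorem AndoTuple.inner_fund₂ (A : AndoTuple T₁ T₂ T E) (h₁ : ‖T₁‖ ≤ 1) (h k : H) :
    inner ℂ (A.fund₂ (defectMap T h)) (defectMap T k) =
      inner ℂ (T₂ h) k - inner ℂ (T h) (T₁ k) := by
  have h1 : A.fund₂ (defectMap T h) = (A.isom.toContinuousLinearMap†)
      (((A.unitary : AndoSpace T₁ T₂ E →L[ℂ] AndoSpace T₁ T₂ E)†)
        (andoProj T₁ T₂ E (A.isom (defectVec T h)))) := rfl
  have h2 : A.isom (defectMap T k) = andoVec (defectVec T₁ (T₂ k)) (defectVec T₂ k) 0 :=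
    A.isom_apply k
  have h3 : (A.unitary : AndoSpace T₁ T₂ E →L[ℂ] AndoSpace T₁ T₂ E) (A.isom (defectMap T k)) =
      andoVec (defectVec T₁ k) (defectVec T₂ (T₁ k)) 0 := by
    rw [h2]; exact A.unitary_apply k
  rw [h1, ContinuousLinearMap.adjoint_inner_left, LinearIsometry.coe_toContinuousLinearMap,
    ContinuousLinearMap.adjoint_inner_left, h3, A.isom_apply, andoProj_andoVec, inner_andoVec,
    ← defectMap_eq_defectVec T₁, ← defectMap_eq_defectVec T₁, inner_defectMap h₁, A.prod_eq,
    inner_zero_left, inner_zero_left, mul_apply_eq_comp]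
  ring

theorem ext_inner_defectMap {x y : defectSpace T}
    (h : ∀ k, inner ℂ x (defectMap T k) = inner ℂ y (defectMap T k)) : x = y :=
  ext_inner_right ℂ fun z => (denseRange_defectMap T).induction_on z
    (isClosed_eq (by fun_prop) (by fun_prop)) h

/-- `D_T X = G D_T + G'* D_T T` when `D_T G D_T = X - Y* T` and `D_T G' D_T = Y - X* T`. -/
theorem defectMap_apply_eq_fund {X Y : H →L[ℂ] H} (hT : ‖T‖ ≤ 1) (hX : X * T = T * X)
    {G G' : defectSpace T →L[ℂ] defectSpace T}
    (hG : ∀ h k, inner ℂ (G (defectMap T h)) (defectMap T k) =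
      inner ℂ (X h) k - inner ℂ (T h) (Y k))
    (hG' : ∀ h k, inner ℂ (G' (defectMap T h)) (defectMap T k) =
      inner ℂ (Y h) k - inner ℂ (T h) (X k)) (h : H) :
    defectMap T (X h) = G (defectMap T h) + (G'†) (defectMap T (T h)) := by
  -- Tested against `D_T k`, the two terms containing `Y` cancel, and commutation identifies `XT`
  -- with `TX`.
  refine ext_inner_defectMap fun k => ?_
  have hc : X (T h) = T (X h) := congrArg (fun A : H →L[ℂ] H => A h) hX
  rw [inner_add_left, hG, ContinuousLinearMap.adjoint_inner_left, ← inner_conj_symm _ (G' _), hG',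
    map_sub, inner_conj_symm, inner_conj_symm, inner_defectMap hT, hc]
  ring

end Ando

/-! ### Resolvents, purity and the kernel identity of the characteristic function. -/

section CharFun

variable {H : Type u} [NormedAddCommGroup H] [InnerProductSpace ℂ H] [CompleteSpace H]
  {H' : Type v} [NormedAddCommGroup H'] [InnerProductSpace ℂ H'] [CompleteSpace H']

/-- `(1 - wA)⁻¹` for a contraction `A` and `w` in the unit disc. -/
def resolv (A : H →L[ℂ] H) (w : ℂ) : H →L[ℂ] H := Ring.inverse (1 - w • A)

theorem isUnit_one_sub_smul {A : H →L[ℂ] H} (hA : ‖A‖ ≤ 1) (z : Complex.UnitDisc) :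
    IsUnit (1 - (z : ℂ) • A) := by
  refine isUnit_one_sub_of_norm_lt_one ?_
  rw [norm_smul]
  exact (mul_le_of_le_one_right (norm_nonneg _) hA).trans_lt z.norm_lt_one

theorem resolv_sub {A : H →L[ℂ] H} (hA : ‖A‖ ≤ 1) (z : Complex.UnitDisc) (h : H) :
    resolv A z (h - (z : ℂ) • A h) = h :=
  congrArg (fun X : H →L[ℂ] H => X h) (Ring.inverse_mul_cancel _ (isUnit_one_sub_smul hA z))

theorem resolv_eq_add {A : H →L[ℂ] H} (hA : ‖A‖ ≤ 1) (z : Complex.UnitDisc) (h : H) :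
    resolv A z h = h + (z : ℂ) • A (resolv A z h) :=
  sub_eq_iff_eq_add.1
    (congrArg (fun X : H →L[ℂ] H => X h) (Ring.mul_inverse_cancel _ (isUnit_one_sub_smul hA z)))

omit [CompleteSpace H] in
theorem resolv_zero (A : H →L[ℂ] H) : resolv A 0 = 1 := by simp [resolv]

theorem apply_resolv {A X : H →L[ℂ] H} (hA : ‖A‖ ≤ 1) (hX : X * A = A * X)
    (z : Complex.UnitDisc) (h : H) : X (resolv A z h) = resolv A z (X h) := by
  have hc : ∀ y, X (A y) = A (X y) := fun y => congrArg (fun Y : H →L[ℂ] H => Y y) hX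
  rw [← resolv_sub hA z (X (resolv A z h)), ← hc, ← map_smul, ← map_sub]
  congr 2
  rw [sub_eq_iff_eq_add]
  exact resolv_eq_add hA z h

theorem continuousAt_resolv_apply (A : H →L[ℂ] H) (h : H) :
    ContinuousAt (fun w => resolv A w h) 0 := by
  have h1 : ContinuousAt (fun X : H →L[ℂ] H => Ring.inverse X) (1 - (0 : ℂ) • A) := by
    rw [zero_smul, sub_zero]
    exact NormedRing.inverse_continuousAt 1
  have h2 : ContinuousAt (resolv A) 0 :=
    ContinuousAt.comp (f := fun w : ℂ => 1 - w • A) h1 (by fun_prop)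
  exact h2.clm_apply continuousAt_const

/-- If `P (1 - zA)⁻¹ h = P' (1 - zA')⁻¹ h'` on the disc, then the same holds with `P A`, `P' A'`. -/
theorem resolv_shift {X : Type*} [NormedAddCommGroup X] [NormedSpace ℂ X]
    {A : H →L[ℂ] H} {A' : H' →L[ℂ] H'} (hA : ‖A‖ ≤ 1) (hA' : ‖A'‖ ≤ 1)
    (P : H →L[ℂ] X) (P' : H' →L[ℂ] X) {h : H} {h' : H'}
    (hP : ∀ z : Complex.UnitDisc, P (resolv A z h) = P' (resolv A' z h'))
    (z : Complex.UnitDisc) : P (A (resolv A z h)) = P' (A' (resolv A' z h')) := by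
  have h0 : P h = P' h' := by simpa [resolv_zero] using hP 0
  -- A backward shift: the value at `0` is subtracted from both sides and the factor `w` is
  -- cancelled. The point `w = 0` is recovered afterwards by continuity.
  have key : ∀ w : ℂ, ‖w‖ < 1 → w ≠ 0 →
      P (A (resolv A w h)) = P' (A' (resolv A' w h')) := by
    intro w hw hw0
    have h1 := hP (Complex.UnitDisc.mk w hw)
    have h2 := resolv_eq_add hA (Complex.UnitDisc.mk w hw) h
    have h3 := resolv_eq_add hA' (Complex.UnitDisc.mk w hw) h'
    rw [h2, h3, map_add, map_add, h0, map_smul, map_smul] at h1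
    exact smul_right_injective X hw0 (add_left_cancel h1)
  by_cases hz : (z : ℂ) = 0
  · rw [hz]
    have c1 : ContinuousAt (fun w => P (A (resolv A w h))) 0 :=
      (P ∘L A).continuous.continuousAt.comp (continuousAt_resolv_apply A h)
    have c2 : ContinuousAt (fun w => P' (A' (resolv A' w h'))) 0 :=
      (P' ∘L A').continuous.continuousAt.comp (continuousAt_resolv_apply A' h')
    refine tendsto_nhds_unique_of_eventuallyEq (c1.mono_left (nhdsWithin_le_nhds (s := {0}ᶜ)))
      (c2.mono_left nhdsWithin_le_nhds) ?_
    filter_upwards [self_mem_nhdsWithin, mem_nhdsWithin_of_mem_nhds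
      (Metric.ball_mem_nhds (0 : ℂ) one_pos)] with w hw hw1
    exact key w (by simpa using hw1) hw
  · exact key z z.norm_lt_one hz

theorem norm_adjoint_le {T : H →L[ℂ] H} (hT : ‖T‖ ≤ 1) : ‖T†‖ ≤ 1 := by
  rwa [LinearIsometryEquiv.norm_map]

/-- For pure `T`, the operators `D_{T*} (1 - zT*)⁻¹` separate the points. -/
theorem IsPure.eq_zero_of_resolv {T : H →L[ℂ] H} (hT : ‖T‖ ≤ 1) (hp : IsPure T) {h : H}
    (hz : ∀ z : Complex.UnitDisc, defectMap (T†) (resolv (T†) z h) = 0) : h = 0 := by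
  have hT' := norm_adjoint_le hT
  -- Shifting repeatedly, with the zero vector on the other side, gives `D_{T*} T*ⁿ h = 0`. Thus
  -- `T*` preserves the norm along the orbit of `h`, while purity sends the orbit to `0`.
  have key : ∀ n : ℕ, ∀ z : Complex.UnitDisc,
      defectMap (T†) (resolv (T†) z (((T†) ^ n) h)) = 0 := by
    intro n
    induction n with
    | zero => simpa using hz
    | succ n ih =>
      intro z
      have := resolv_shift hT' hT' (defectMap (T†)) 0 (h' := 0) (by simpa using ih) z
      rw [apply_resolv hT' rfl] at this
      simpa [pow_succ'] using this
  have hnorm : ∀ n : ℕ, ‖((T†) ^ n) h‖ = ‖h‖ := by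
    intro n
    induction n with
    | zero => simp
    | succ n ih =>
      have h1 : defectMap (T†) (((T†) ^ n) h) = 0 := by simpa [resolv_zero] using key n 0
      have h2 := norm_sq_defectMap hT' (((T†) ^ n) h)
      rw [h1, norm_zero] at h2
      rw [← ih, pow_succ', mul_apply_eq_comp]
      refine (sq_eq_sq₀ (norm_nonneg _) (norm_nonneg _)).1 ?_
      linarith
  have h1 := (hp h).norm
  simp only [hnorm, norm_zero] at h1
  exact norm_eq_zero.1 (tendsto_nhds_unique tendsto_const_nhds h1)

/-- Since `T D_T = D_{T*} T`, the operator `D_{T*}` comes out on the left, and `D_T² = 1 - T*T`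
removes the inner square root. On the dense range of `D_T`, computations with `Θ_T` thus become
algebra in `T`, `T*` and the resolvent. -/
theorem charFun_defectMap {T : H →L[ℂ] H} (hT : ‖T‖ ≤ 1) (z : Complex.UnitDisc) (h : H) :
    charFun T hT z (defectMap T h) =
      defectMap (T†) (-T h + (z : ℂ) • resolv (T†) z (h - (T†) (T h))) := by
  apply Subtype.ext
  rw [coe_defectMap, map_add, map_neg, map_smul, defectOp_adjoint_apply hT, ← defectOp_defectOp hT]
  rfl

theorem adjoint_charFun_defectMap {T : H →L[ℂ] H} (hT : ‖T‖ ≤ 1) (z : Complex.UnitDisc) (k : H) :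
    ((charFun T hT z)†) (defectMap (T†) k) =
      defectMap T (-(T†) k + (starRingEnd ℂ z) • ((resolv (T†) z)†) (k - T ((T†) k))) := by
  refine ext_inner_defectMap fun h => ?_
  rw [ContinuousLinearMap.adjoint_inner_left, charFun_defectMap,
    ← ContinuousLinearMap.adjoint_inner_left, ← ContinuousLinearMap.adjoint_inner_right (defectMap T),
    adjoint_defectMap_apply, adjoint_defectMap_apply, coe_defectMap, coe_defectMap,
    defectOp_defectOp hT, defectOp_defectOp (norm_adjoint_le hT),
    ContinuousLinearMap.adjoint_adjoint, inner_add_left, inner_add_right, inner_smul_left,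
    inner_smul_right, ContinuousLinearMap.adjoint_inner_left, Complex.conj_conj]
  simp only [inner_sub_left, inner_sub_right, inner_neg_left, inner_neg_right,
    ContinuousLinearMap.adjoint_inner_left, ContinuousLinearMap.adjoint_inner_right, map_neg]
  ring

/-- The vectors `(1 - z̄T)⁻¹ D_{T*} y`. -/
def kernelMap (T : H →L[ℂ] H) (z : ℂ) : defectSpace (T†) →L[ℂ] H :=
  (defectMap (T†) ∘L resolv (T†) z)†

theorem kernelMap_defectMap {T : H →L[ℂ] H} (hT : ‖T‖ ≤ 1) (z : ℂ) (k : H) :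
    kernelMap T z (defectMap (T†) k) = ((resolv (T†) z)†) (k - T ((T†) k)) := by
  rw [kernelMap, ContinuousLinearMap.adjoint_comp, ContinuousLinearMap.comp_apply,
    adjoint_defectMap_apply, coe_defectMap, defectOp_defectOp (norm_adjoint_le hT),
    ContinuousLinearMap.adjoint_adjoint]

/-- `I - Θ_T(z) Θ_T(w)* = (1 - z w̄) D_{T*} (1 - zT*)⁻¹ (1 - w̄T)⁻¹ D_{T*}`. -/
theorem inner_adjoint_charFun {T : H →L[ℂ] H} (hT : ‖T‖ ≤ 1) (w z : Complex.UnitDisc)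
    (y x : defectSpace (T†)) :
    inner ℂ (((charFun T hT w)†) y) (((charFun T hT z)†) x) =
      inner ℂ y x - (1 - (w : ℂ) * starRingEnd ℂ z) *
        inner ℂ (kernelMap T w y) (kernelMap T z x) := by
  refine (denseRange_defectMap (T†)).induction_on₂ (p := fun y x =>
    inner ℂ (((charFun T hT w)†) y) (((charFun T hT z)†) x) =
      inner ℂ y x - (1 - (w : ℂ) * starRingEnd ℂ z) *
        inner ℂ (kernelMap T w y) (kernelMap T z x))
    (isClosed_eq (by fun_prop) (by fun_prop)) (fun k l => ?_) y x
  rw [adjoint_charFun_defectMap, adjoint_charFun_defectMap, kernelMap_defectMap hT,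
    kernelMap_defectMap hT, inner_defectMap (norm_adjoint_le hT)]
  have hres : ∀ (w : Complex.UnitDisc) m, ((resolv (T†) w)†) m - (starRingEnd ℂ w) • T (((resolv (T†) w)†) m) = m := by
    intro w m
    refine ext_inner_right ℂ fun n => ?_
    have h1 := congrArg (inner ℂ m) (resolv_sub (norm_adjoint_le hT) w n)
    rw [← h1, ← ContinuousLinearMap.adjoint_inner_left, inner_sub_left, inner_sub_right,
      inner_smul_left, inner_smul_right, Complex.conj_conj, ContinuousLinearMap.adjoint_inner_right]
  have hk := hres w (k - T ((T†) k))
  have hl := hres z (l - T ((T†) l))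
  -- Only `(1 - w̄T) k' = (1 - TT*) k` and its analogue for `l'` are needed from here on. By the
  -- first, `D_T²(-T*k + w̄k')` simplifies to `w̄k' - T*k'`.
  generalize ((resolv (T†) w)†) (k - T ((T†) k)) = k' at hk ⊢
  generalize ((resolv (T†) z)†) (l - T ((T†) l)) = l' at hl ⊢
  have hq : inner ℂ (defectMap T (-(T†) k + (starRingEnd ℂ w) • k'))
      (defectMap T (-(T†) l + (starRingEnd ℂ z) • l')) =
      inner ℂ ((starRingEnd ℂ w) • k' - (T†) k') (-(T†) l + (starRingEnd ℂ z) • l') := by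
    rw [← ContinuousLinearMap.adjoint_inner_left, adjoint_defectMap_apply, coe_defectMap,
      defectOp_defectOp hT]
    congr 1
    have h2 := congrArg (T†) hk
    simp only [map_sub, map_add, map_smul, map_neg] at h2 ⊢
    have h3 : (T†) k = (T†) k' - (starRingEnd ℂ w) • (T†) (T k') + (T†) (T ((T†) k)) := by
      rw [h2]; abel
    nth_rw 1 [h3]
    abel
  have h4 : (starRingEnd ℂ w) • T k' = k' - (k - T ((T†) k)) := by rw [← hk]; abel
  have h5 : inner ℂ ((starRingEnd ℂ w) • k' - (T†) k') ((T†) l) =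
      inner ℂ k' l - inner ℂ k l + inner ℂ ((T†) k) ((T†) l) - inner ℂ ((T†) k') ((T†) l) := by
    rw [inner_sub_left, ContinuousLinearMap.adjoint_inner_right, map_smul, h4]
    simp only [inner_sub_left]
    rw [ContinuousLinearMap.adjoint_inner_right T ((T†) k)]
    ring
  have h6 : inner ℂ k' l - inner ℂ ((T†) k') ((T†) l) =
      inner ℂ k' l' - starRingEnd ℂ z * inner ℂ ((T†) k') l' := by
    have h7 := congrArg (inner ℂ k') hl
    rw [inner_sub_right, inner_sub_right, inner_smul_right] at h7
    rw [ContinuousLinearMap.adjoint_inner_left, ContinuousLinearMap.adjoint_inner_left, h7]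
  rw [hq, inner_add_right, inner_neg_right, h5, inner_smul_right, inner_sub_left, inner_smul_left,
    Complex.conj_conj]
  linear_combination -h6

end CharFun

/-! ### The two directions of the equivalence. -/

section Main

variable {H : Type u} [NormedAddCommGroup H] [InnerProductSpace ℂ H] [CompleteSpace H]
  {H' : Type v} [NormedAddCommGroup H'] [InnerProductSpace ℂ H'] [CompleteSpace H']

theorem CommutingContractions.adjoint_comm (S : CommutingContractions H) :
    S.T₁† * S.T₂† = S.T₂† * S.T₁† := by
  have := congrArg star S.comm
  rw [star_mul, star_mul] at this
  exact this.symm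

theorem CommutingContractions.adjoint_prod (S : CommutingContractions H) :
    S.prod† = S.T₁† * S.T₂† := by
  rw [S.adjoint_comm]
  exact star_mul S.T₁ S.T₂

theorem CommutingContractions.adjoint_comm_prod (S : CommutingContractions H) :
    S.T₁† * S.prod† = S.prod† * S.T₁† ∧ S.T₂† * S.prod† = S.prod† * S.T₂† := by
  rw [S.adjoint_prod]
  refine ⟨?_, ?_⟩
  · rw [mul_assoc, ← S.adjoint_comm]
  · rw [mul_assoc, ← mul_assoc, ← S.adjoint_comm, mul_assoc]

theorem exists_isCharacteristicTriple (S : CommutingContractions H) :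
    ∃ τ, IsCharacteristicTriple S τ := by
  obtain ⟨A⟩ := exists_andoTuple (norm_adjoint_le S.norm_le₁) (norm_adjoint_le S.norm_le₂)
    S.adjoint_comm S.adjoint_prod
  exact ⟨⟨A.fund₁, A.fund₂, charFun S.prod S.norm_prod_le⟩, _, inferInstance, inferInstance,
    inferInstance, A, rfl, rfl, rfl⟩

section

variable {S : CommutingContractions H}
  {τ : OperatorTriple (defectSpace S.prod) (defectSpace (S.prod†))}

theorem IsCharacteristicTriple.inner_G₁ (hτ : IsCharacteristicTriple S τ) (h k : H) :
    inner ℂ (τ.G₁ (defectMap (S.prod†) h)) (defectMap (S.prod†) k) =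
      inner ℂ ((S.T₁†) h) k - inner ℂ ((S.prod†) h) ((S.T₂†) k) := by
  obtain ⟨E, _, _, _, A, h1, -, -⟩ := hτ
  rw [h1, A.inner_fund₁ (norm_adjoint_le S.norm_le₂) S.adjoint_comm]

theorem IsCharacteristicTriple.inner_G₂ (hτ : IsCharacteristicTriple S τ) (h k : H) :
    inner ℂ (τ.G₂ (defectMap (S.prod†) h)) (defectMap (S.prod†) k) =
      inner ℂ ((S.T₂†) h) k - inner ℂ ((S.prod†) h) ((S.T₁†) k) := by
  obtain ⟨E, _, _, _, A, -, h2, -⟩ := hτ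
  rw [h2, A.inner_fund₂ (norm_adjoint_le S.norm_le₁)]

theorem IsCharacteristicTriple.Θ_eq (hτ : IsCharacteristicTriple S τ) :
    τ.Θ = charFun S.prod S.norm_prod_le := by
  obtain ⟨E, _, _, _, A, -, -, h3⟩ := hτ
  exact h3

end

section Intertwine

variable {A B : H →L[ℂ] H} {A' B' : H' →L[ℂ] H'} (U : H ≃ₗᵢ[ℂ] H')

theorem adjoint_intertwine (hU : ∀ h, U (A h) = A' (U h)) (h : H) :
    U ((A†) h) = (A'†) (U h) := by
  refine ext_inner_right ℂ fun y => ?_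
  obtain ⟨k, rfl⟩ := U.surjective y
  rw [ContinuousLinearMap.adjoint_inner_left, ← hU, U.inner_map_map, U.inner_map_map,
    ContinuousLinearMap.adjoint_inner_left]

theorem resolv_intertwine (hA : ‖A‖ ≤ 1) (hA' : ‖A'‖ ≤ 1) (hU : ∀ h, U (A h) = A' (U h))
    (z : Complex.UnitDisc) (h : H) : U (resolv A z h) = resolv A' z (U h) := by
  rw [← resolv_sub hA' z (U (resolv A z h)), ← hU, ← map_smul, ← map_sub]
  congr 2
  rw [sub_eq_iff_eq_add]
  exact resolv_eq_add hA z h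

theorem exists_defectMap_intertwine (hA : ‖A‖ ≤ 1) (hA' : ‖A'‖ ≤ 1)
    (hU : ∀ h, U (A h) = A' (U h)) :
    ∃ w : defectSpace A ≃ₗᵢ[ℂ] defectSpace A', ∀ h, w (defectMap A h) = defectMap A' (U h) := by
  refine exists_linearIsometryEquiv_of_norm_eq (defectMap A).toLinearMap
    ((defectMap A').toLinearMap ∘ₗ U.toLinearEquiv.toLinearMap) (denseRange_defectMap A)
    ((denseRange_defectMap A').comp U.surjective.denseRange (defectMap A').continuous)
    fun h => ?_
  refine (sq_eq_sq₀ (norm_nonneg _) (norm_nonneg _)).1 ?_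
  change ‖defectMap A' (U h)‖ ^ 2 = ‖defectMap A h‖ ^ 2
  rw [norm_sq_defectMap hA, norm_sq_defectMap hA', ← hU, U.norm_map, U.norm_map]

/-- The form on the dense range of `D_A` determines `G` from `A`, `X`, `Y`, so intertwining these
three operators intertwines `G`. -/
theorem fund_intertwine {X Y : H →L[ℂ] H} {X' Y' : H' →L[ℂ] H'}
    (hU : ∀ h, U (A h) = A' (U h)) (hX : ∀ h, U (X h) = X' (U h)) (hY : ∀ h, U (Y h) = Y' (U h))
    {w : defectSpace A ≃ₗᵢ[ℂ] defectSpace A'} (hw : ∀ h, w (defectMap A h) = defectMap A' (U h))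
    {G : defectSpace A →L[ℂ] defectSpace A} {G' : defectSpace A' →L[ℂ] defectSpace A'}
    (hG : ∀ h k, inner ℂ (G (defectMap A h)) (defectMap A k) =
      inner ℂ (X h) k - inner ℂ (A h) (Y k))
    (hG' : ∀ h k, inner ℂ (G' (defectMap A' h)) (defectMap A' k) =
      inner ℂ (X' h) k - inner ℂ (A' h) (Y' k))
    (y : defectSpace A) : w (G y) = G' (w y) := by
  refine (denseRange_defectMap A).induction_on y (isClosed_eq (by fun_prop) (by fun_prop))
    fun h => ext_inner_defectMap fun k => ?_
  obtain ⟨k, rfl⟩ := U.surjective k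
  rw [hw, hG', ← hw, w.inner_map_map, hG, ← hU, ← hX, ← hY, U.inner_map_map, U.inner_map_map]

end Intertwine

variable {S : CommutingContractions H} {S' : CommutingContractions H'}
  {τ : OperatorTriple (defectSpace S.prod) (defectSpace (S.prod†))}
  {τ' : OperatorTriple (defectSpace S'.prod) (defectSpace (S'.prod†))}

/-- Characteristic triples of unitarily equivalent pairs coincide. -/
theorem UnitarilyEquivalent.coincides (hτ : IsCharacteristicTriple S τ)
    (hτ' : IsCharacteristicTriple S' τ') (h : UnitarilyEquivalent S S') : τ.Coincides τ' := by
  obtain ⟨U, h1, h2⟩ := h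
  have hp : ∀ h, U (S.prod h) = S'.prod (U h) := fun h => by
    change U (S.T₁ (S.T₂ h)) = S'.T₁ (S'.T₂ (U h))
    rw [h1, h2]
  have hps := adjoint_intertwine U hp
  have h1s := adjoint_intertwine U h1
  have h2s := adjoint_intertwine U h2
  have hn := norm_adjoint_le S.norm_prod_le
  have hn' := norm_adjoint_le S'.norm_prod_le
  obtain ⟨w, hw⟩ := exists_defectMap_intertwine U S.norm_prod_le S'.norm_prod_le hp
  obtain ⟨ws, hws⟩ := exists_defectMap_intertwine U hn hn' hps
  refine ⟨w, ws, fun z x => ?_, fund_intertwine U hps h1s h2s hws hτ.inner_G₁ hτ'.inner_G₁,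
    fund_intertwine U hps h2s h1s hws hτ.inner_G₂ hτ'.inner_G₂⟩
  rw [hτ.Θ_eq, hτ'.Θ_eq]
  refine (denseRange_defectMap S.prod).induction_on x
    (isClosed_eq (by fun_prop) (by fun_prop)) fun h => ?_
  rw [hw, charFun_defectMap, charFun_defectMap, hws]
  congr 1
  rw [map_add, map_neg, map_smul, resolv_intertwine U hn hn' hps, map_sub U, hps, hp]

/-- The kernel identity expresses `1 - a b̄` times the Gram entry through `Θ_T`, and the factor is
nonzero because `|a b̄| < 1`. -/
theorem inner_kernelMap_eq {T : H →L[ℂ] H} {T' : H' →L[ℂ] H'} (hT : ‖T‖ ≤ 1) (hT' : ‖T'‖ ≤ 1)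
    (w : defectSpace T ≃ₗᵢ[ℂ] defectSpace T') (ws : defectSpace (T†) ≃ₗᵢ[ℂ] defectSpace (T'†))
    (hΘ : ∀ z x, charFun T' hT' z (w x) = ws (charFun T hT z x))
    (a b : Complex.UnitDisc) (y x : defectSpace (T†)) :
    inner ℂ (kernelMap T' a (ws y)) (kernelMap T' b (ws x)) =
      inner ℂ (kernelMap T a y) (kernelMap T b x) := by
  have hadj : ∀ z y, ((charFun T' hT' z)†) (ws y) = w (((charFun T hT z)†) y) := by
    intro z y
    refine ext_inner_right ℂ fun x => ?_
    obtain ⟨x, rfl⟩ := w.surjective x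
    rw [ContinuousLinearMap.adjoint_inner_left, hΘ, ws.inner_map_map, w.inner_map_map,
      ContinuousLinearMap.adjoint_inner_left]
  have h0 := inner_adjoint_charFun hT a b y x
  have h1 := inner_adjoint_charFun hT' a b (ws y) (ws x)
  have h2 := ws.inner_map_map y x
  have h3 := (congrArg₂ (inner ℂ) (hadj a y) (hadj b x)).trans (w.inner_map_map _ _)
  have hne : 1 - (a : ℂ) * starRingEnd ℂ b ≠ 0 := by
    intro h
    have h2 : ‖(a : ℂ) * starRingEnd ℂ b‖ = 1 := by rw [← sub_eq_zero.1 h, norm_one]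
    rw [norm_mul, RCLike.norm_conj] at h2
    have := mul_lt_one_of_nonneg_of_lt_one_left (norm_nonneg _) a.norm_lt_one b.norm_lt_one.le
    exact this.ne h2
  exact mul_left_cancel₀ hne (by linear_combination h1 - h0 + h2 - h3)

theorem IsPure.eq_zero_of_inner_kernelMap {T : H →L[ℂ] H} (hT : ‖T‖ ≤ 1) (hp : IsPure T) {h : H}
    (hh : ∀ (z : Complex.UnitDisc) y, inner ℂ h (kernelMap T z y) = 0) : h = 0 := by
  refine hp.eq_zero_of_resolv hT fun z => ext_inner_right ℂ fun y => ?_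
  rw [inner_zero_left, ← hh z y, kernelMap, ContinuousLinearMap.adjoint_inner_right]
  rfl

/-- For pure `T` and `T'`, coincidence of the characteristic functions gives a unitary that
intertwines `D_{T*} (1 - zT*)⁻¹` with `D_{T'*} (1 - zT'*)⁻¹`. -/
theorem exists_unitary_of_charFun {T : H →L[ℂ] H} {T' : H' →L[ℂ] H'}
    (hT : ‖T‖ ≤ 1) (hT' : ‖T'‖ ≤ 1) (hp : IsPure T) (hp' : IsPure T')
    (w : defectSpace T ≃ₗᵢ[ℂ] defectSpace T') (ws : defectSpace (T†) ≃ₗᵢ[ℂ] defectSpace (T'†))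
    (hΘ : ∀ z x, charFun T' hT' z (w x) = ws (charFun T hT z x)) :
    ∃ U : H ≃ₗᵢ[ℂ] H', ∀ (z : Complex.UnitDisc) h,
      ws (defectMap (T†) (resolv (T†) z h)) = defectMap (T'†) (resolv (T'†) z (U h)) := by
  obtain ⟨U, hU⟩ := exists_linearIsometryEquiv_of_gram_eq
    (fun i : Complex.UnitDisc × defectSpace (T†) => kernelMap T i.1 i.2)
    (fun i => kernelMap T' i.1 (ws i.2))
    (fun x hx => hp.eq_zero_of_inner_kernelMap hT fun z y => hx (z, y))
    (fun x hx => hp'.eq_zero_of_inner_kernelMap hT' fun z y => by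
      obtain ⟨y, rfl⟩ := ws.surjective y
      exact hx (z, y))
    (fun i j => inner_kernelMap_eq hT hT' w ws hΘ _ _ _ _)
  refine ⟨U, fun z h => ext_inner_right ℂ fun y => ?_⟩
  obtain ⟨y, rfl⟩ := ws.surjective y
  have h1 : inner ℂ (defectMap (T'†) (resolv (T'†) z (U h))) (ws y) =
      inner ℂ (U h) (kernelMap T' z (ws y)) := by
    rw [kernelMap, ContinuousLinearMap.adjoint_inner_right]; rfl
  have h2 : inner ℂ (defectMap (T†) (resolv (T†) z h)) y = inner ℂ h (kernelMap T z y) := by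
    rw [kernelMap, ContinuousLinearMap.adjoint_inner_right]; rfl
  -- `U` maps kernel vectors to kernel vectors; this is the adjoint form of that statement.
  rw [h1, ws.inner_map_map, h2, ← hU (z, y), U.inner_map_map]

/-- A unitary that intertwines `D_{T*} (1 - zT*)⁻¹` with `D_{T'*} (1 - zT'*)⁻¹` along `ws`
intertwines `X` with `X'` if `ws` intertwines the fundamental operators. -/
theorem intertwine_of_fund {T : H →L[ℂ] H} {T' : H' →L[ℂ] H'}
    (hT : ‖T‖ ≤ 1) (hT' : ‖T'‖ ≤ 1) (hp' : IsPure T')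
    {ws : defectSpace (T†) ≃ₗᵢ[ℂ] defectSpace (T'†)} {U : H ≃ₗᵢ[ℂ] H'}
    (hU : ∀ (z : Complex.UnitDisc) h,
      ws (defectMap (T†) (resolv (T†) z h)) = defectMap (T'†) (resolv (T'†) z (U h)))
    {X : H →L[ℂ] H} {X' : H' →L[ℂ] H'} (hX : X * T† = T† * X) (hX' : X' * T'† = T'† * X')
    {G F : defectSpace (T†) →L[ℂ] defectSpace (T†)}
    {G' F' : defectSpace (T'†) →L[ℂ] defectSpace (T'†)}
    (hG : ∀ y, ws (G y) = G' (ws y)) (hF : ∀ y, ws (F y) = F' (ws y))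
    (hXG : ∀ h, defectMap (T†) (X h) =
      G (defectMap (T†) h) + (F†) (defectMap (T†) ((T†) h)))
    (hXG' : ∀ h, defectMap (T'†) (X' h) =
      G' (defectMap (T'†) h) + (F'†) (defectMap (T'†) ((T'†) h))) (h : H) :
    U (X h) = X' (U h) := by
  have hn := norm_adjoint_le hT
  have hn' := norm_adjoint_le hT'
  have hFs : ∀ y, ws ((F†) y) = (F'†) (ws y) := adjoint_intertwine ws hF
  rw [← sub_eq_zero]
  -- Purity of `T'` allows the check to be made after applying `D_{T'*} (1 - zT'*)⁻¹`. The term with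
  -- `F` involves `D_{T*} T* (1 - zT*)⁻¹`, whose intertwining comes from the shift.
  refine hp'.eq_zero_of_resolv hT' fun z => ?_
  have hshift := resolv_shift hn hn'
    ((ws : defectSpace (T†) →L[ℂ] defectSpace (T'†)) ∘L defectMap (T†)) (defectMap (T'†))
    (fun z => hU z h) z
  have hshift' : ws (defectMap (T†) ((T†) (resolv (T†) z h))) =
      defectMap (T'†) ((T'†) (resolv (T'†) z (U h))) := hshift
  rw [map_sub, map_sub, sub_eq_zero]
  symm
  calc defectMap (T'†) (resolv (T'†) z (X' (U h)))
      = G' (defectMap (T'†) (resolv (T'†) z (U h))) +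
          (F'†) (defectMap (T'†) ((T'†) (resolv (T'†) z (U h)))) := by
        rw [← apply_resolv hn' hX']
        exact hXG' _
    _ = G' (ws (defectMap (T†) (resolv (T†) z h))) +
          (F'†) (ws (defectMap (T†) ((T†) (resolv (T†) z h)))) :=
        congrArg₂ (fun p q => G' p + (F'†) q) (hU z h).symm hshift'.symm
    _ = ws (G (defectMap (T†) (resolv (T†) z h)) +
          (F†) (defectMap (T†) ((T†) (resolv (T†) z h)))) :=
        ((map_add ws _ _).trans (congrArg₂ (· + ·) (hG _) (hFs _))).symm
    _ = ws (defectMap (T†) (X (resolv (T†) z h))) := congrArg ws (hXG _).symm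
    _ = ws (defectMap (T†) (resolv (T†) z (X h))) :=
        congrArg (fun k => ws (defectMap (T†) k)) (apply_resolv hn hX z h)
    _ = defectMap (T'†) (resolv (T'†) z (U (X h))) := hU z (X h)

/-- Pairs with pure products and coinciding characteristic triples are unitarily equivalent. -/
theorem unitarilyEquivalent_of_coincides (hS : IsPure S.prod) (hS' : IsPure S'.prod)
    (hτ : IsCharacteristicTriple S τ) (hτ' : IsCharacteristicTriple S' τ')
    (h : τ.Coincides τ') : UnitarilyEquivalent S S' := by
  obtain ⟨w, ws, hΘ, h1, h2⟩ := h
  rw [hτ.Θ_eq, hτ'.Θ_eq] at hΘ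
  obtain ⟨U, hU⟩ := exists_unitary_of_charFun S.norm_prod_le S'.norm_prod_le hS hS' w ws hΘ
  obtain ⟨c1, c2⟩ := S.adjoint_comm_prod
  obtain ⟨c1', c2'⟩ := S'.adjoint_comm_prod
  have hn := norm_adjoint_le S.norm_prod_le
  have hn' := norm_adjoint_le S'.norm_prod_le
  have e1 := intertwine_of_fund S.norm_prod_le S'.norm_prod_le hS' hU c1 c1' h1 h2
    (defectMap_apply_eq_fund hn c1 hτ.inner_G₁ hτ.inner_G₂)
    (defectMap_apply_eq_fund hn' c1' hτ'.inner_G₁ hτ'.inner_G₂)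
  -- The hypotheses are symmetric under exchanging `T₁`, `G₁` with `T₂`, `G₂`.
  have e2 := intertwine_of_fund S.norm_prod_le S'.norm_prod_le hS' hU c2 c2' h2 h1
    (defectMap_apply_eq_fund hn c2 hτ.inner_G₂ hτ.inner_G₁)
    (defectMap_apply_eq_fund hn' c2' hτ'.inner_G₂ hτ'.inner_G₁)
  -- `e1` and `e2` concern `T₁*` and `T₂*`; since `U` is unitary, taking adjoints returns to `T₁`
  -- and `T₂`.
  refine ⟨U, fun h => ?_, fun h => ?_⟩
  · simpa only [ContinuousLinearMap.adjoint_adjoint] using adjoint_intertwine U e1 h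
  · simpa only [ContinuousLinearMap.adjoint_adjoint] using adjoint_intertwine U e2 h

end Main

end CommutingPair

end

theorem theorem1p5
    {H : Type u} [NormedAddCommGroup H] [InnerProductSpace ℂ H] [CompleteSpace H]
    {H' : Type v} [NormedAddCommGroup H'] [InnerProductSpace ℂ H'] [CompleteSpace H']
    (S : CommutingPair.CommutingContractions H) (S' : CommutingPair.CommutingContractions H')
    (hS : CommutingPair.IsPure S.prod) (hS' : CommutingPair.IsPure S'.prod) :
    (∃ τ, CommutingPair.IsCharacteristicTriple S τ) ∧
    (∃ τ', CommutingPair.IsCharacteristicTriple S' τ') ∧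
    ∀ τ τ', CommutingPair.IsCharacteristicTriple S τ →
      CommutingPair.IsCharacteristicTriple S' τ' →
      (CommutingPair.UnitarilyEquivalent S S' ↔ τ.Coincides τ') := by
  refine ⟨CommutingPair.exists_isCharacteristicTriple S,
    CommutingPair.exists_isCharacteristicTriple S', fun τ τ' hτ hτ' => ⟨fun h => ?_, fun h => ?_⟩⟩
  · exact h.coincides hτ hτ'
  · exact CommutingPair.unitarilyEquivalent_of_coincides hS hS' hτ hτ' h
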